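/- For a positive integer $n$ let $Z(n)=\sum \frac{1}{ijk}$, where the sum is over all ordered triples $(i,j,k)$ of positive integers with $i+j+k=n$ and each of $i,j,k$ coprime to $n$. Let $B_k$ denote the Bernoulli numbers, given by $B_0=1$ and $\sum_{i=0}^{n}\binom{n+1}{i}B_i=0$ for $n\ge 1$. Let $p,q$ be distinct odd primes and $\alpha,\beta$ positive integers. Then $$Z(p^{\alpha}q^{\beta})\equiv 2(2-q)\left(1-\frac{1}{q^{3}}\right)p^{\alpha-1}q^{\beta-1}B_{p-3}\pmod{p^{\alpha}}.$$ Here a congruence $x\equiv y\pmod m$ between rational numbers means that $x$ and $y$ have denominators coprime to $m$ and that $m$ divides the numerator of $x-y$ in lowest terms. -/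

import Mathlib

/-- `Z(n) = ∑ 1 / (i j k)`, a rational number: the sum over all ordered triples `(i, j, k)` of
positive integers, each prime to `n`, with `i + j + k = n`. -/
def harmonicZ (n : ℕ) : ℚ :=
  ∑ t ∈ (Finset.Icc 1 n ×ˢ Finset.Icc 1 n ×ˢ Finset.Icc 1 n).filter
      (fun t : ℕ × ℕ × ℕ => t.1 + t.2.1 + t.2.2 = n ∧
        t.1.Coprime n ∧ t.2.1.Coprime n ∧ t.2.2.Coprime n),
    1 / ((t.1 : ℚ) * (t.2.1 : ℚ) * (t.2.2 : ℚ))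

/-- Congruence modulo `m` of rational numbers that are integral at `m`: the denominators of `x`
and `y` are prime to `m`, and `m` divides the numerator of `x - y` in lowest terms. -/
def RatModEq (m : ℕ) (x y : ℚ) : Prop :=
  x.den.Coprime m ∧ y.den.Coprime m ∧ (m : ℤ) ∣ (x - y).num

/-!
`Z n` is the coefficient of `X ^ n` in the cube of `S = ∑ X ^ i / i`, summed over the `i` prime
to `n`. Modulo a divisor of `n ^ 2` the coefficients of `S` are arithmetic progressions along each
residue class modulo `n`, so `S` is rational with denominator a power of `1 - X ^ n`. Expanding the
cube, and using that `i ↦ n - i` negates `1 / i` modulo `n`, yields `Z (n * m) ≡ m * Z n` modulo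
every common divisor of `n ^ 2` and `m.choose 2 * n`, when the prime factors of `m` divide `n`. This
reduces the theorem to `Z (p * q)` modulo `p`.

There the `i` divisible by `q` are removed by subtracting `q⁻¹ * S (X ^ q)`, and partial fractions
express `Z (p * q)` through the double sum of the `1 / (i * i * j)` over `j < i < p` and the sum of
the `⌊q * i / p⌋ / (q * i) ^ 3` over `i < p`. The first is `B_{p-3}` by Faulhaber's formula; the
second is a multiple of `B_{p-3}` by Voronoi's congruence, which comes from expanding
`(q * i - p * ⌊q * i / p⌋) ^ k` modulo `p ^ 2`.
-/

open Finset hiding mk antidiagonal mem_antidiagonal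
open Finset.HasAntidiagonal (antidiagonal mem_antidiagonal)
open PowerSeries

/-- The graph of the reduction of rational numbers modulo `m`: the pairs `(x, r)` for which `x` has
denominator prime to `m` and residue `r`. As a subring it records that reduction is additive and
multiplicative. -/
def residueGraph (m : ℕ) : Subring (ℚ × ZMod m) where
  carrier := {z | ∃ (a : ℤ) (d : ℕ), d.Coprime m ∧ z.1 * d = a ∧ z.2 * d = a}
  zero_mem' := ⟨0, 1, by simp⟩
  one_mem' := ⟨1, 1, by simp⟩
  neg_mem' := by
    rintro ⟨x, r⟩ ⟨a, d, hd, hx, hr⟩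
    exact ⟨-a, d, hd, by simp [← hx], by simp [← hr]⟩
  add_mem' := by
    rintro ⟨x, r⟩ ⟨y, s⟩ ⟨a, d, hd, hx, hr⟩ ⟨b, e, he, hy, hs⟩
    refine ⟨a * e + b * d, d * e, hd.mul_left he, ?_, ?_⟩ <;>
      push_cast [Prod.fst_add, Prod.snd_add]
    · linear_combination e * hx + d * hy
    · linear_combination e * hr + d * hs
  mul_mem' := by
    rintro ⟨x, r⟩ ⟨y, s⟩ ⟨a, d, hd, hx, hr⟩ ⟨b, e, he, hy, hs⟩
    refine ⟨a * b, d * e, hd.mul_left he, ?_, ?_⟩ <;> push_cast [Prod.fst_mul, Prod.snd_mul]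
    · linear_combination y * e * hx + a * hy
    · linear_combination s * e * hr + a * hs

/-- The rational number `x` has denominator prime to `m` and residue `r` modulo `m`. -/
def ReducesTo (m : ℕ) (x : ℚ) (r : ZMod m) : Prop :=
  (x, r) ∈ residueGraph m

namespace ReducesTo

variable {m : ℕ} {x y : ℚ} {r s : ZMod m}

theorem sub (hx : ReducesTo m x r) (hy : ReducesTo m y s) : ReducesTo m (x - y) (r - s) :=
  sub_mem hx hy

theorem mul (hx : ReducesTo m x r) (hy : ReducesTo m y s) : ReducesTo m (x * y) (r * s) :=
  mul_mem hx hy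

theorem pow (hx : ReducesTo m x r) (n : ℕ) : ReducesTo m (x ^ n) (r ^ n) :=
  pow_mem hx n

theorem natCast (m a : ℕ) : ReducesTo m a a :=
  natCast_mem _ a

theorem intCast (m : ℕ) (a : ℤ) : ReducesTo m a a :=
  intCast_mem _ a

theorem sum {ι : Type*} {t : Finset ι} {f : ι → ℚ} {g : ι → ZMod m}
    (h : ∀ i ∈ t, ReducesTo m (f i) (g i)) : ReducesTo m (∑ i ∈ t, f i) (∑ i ∈ t, g i) := by
  have := sum_mem h
  rwa [← prod_mk_sum] at this

theorem inv_natCast {d : ℕ} (hd : d.Coprime m) (h0 : d ≠ 0) :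
    ReducesTo m (d : ℚ)⁻¹ (d : ZMod m)⁻¹ := by
  refine ⟨1, d, hd, by simp [h0], ?_⟩
  rw [mul_comm, ZMod.coe_mul_inv_eq_one d hd, Int.cast_one]

theorem coeff_mul {φ φ' : ℚ⟦X⟧} {ψ ψ' : (ZMod m)⟦X⟧}
    (h : ∀ n, ReducesTo m (coeff n φ) (coeff n ψ))
    (h' : ∀ n, ReducesTo m (coeff n φ') (coeff n ψ')) (n : ℕ) :
    ReducesTo m (coeff n (φ * φ')) (coeff n (ψ * ψ')) := by
  simp only [PowerSeries.coeff_mul]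
  exact sum fun x _ => (h x.1).mul (h' x.2)

theorem coeff_pow {φ : ℚ⟦X⟧} {ψ : (ZMod m)⟦X⟧} (h : ∀ n, ReducesTo m (coeff n φ) (coeff n ψ))
    (k n : ℕ) : ReducesTo m (coeff n (φ ^ k)) (coeff n (ψ ^ k)) := by
  induction k generalizing n with
  | zero =>
    simp only [pow_zero, coeff_one]
    split_ifs
    exacts [one_mem _, zero_mem _]
  | succ k ih => exact coeff_mul ih h n

theorem unique (hx : ReducesTo m x r) (hy : ReducesTo m x s) : r = s := by
  obtain ⟨a, d, hd, hxa, hra⟩ := hx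
  obtain ⟨b, e, he, hxb, hsb⟩ := hy
  have hab : a * e = b * d := by
    have : (a : ℚ) * e = b * d := by linear_combination d * hxb - e * hxa
    exact_mod_cast this
  have hab' : (a : ZMod m) * e = b * d := by exact_mod_cast congrArg (Int.cast : ℤ → ZMod m) hab
  have hde : IsUnit ((d : ZMod m) * e) :=
    ((ZMod.unitOfCoprime d hd).isUnit).mul (ZMod.unitOfCoprime e he).isUnit
  refine hde.mul_right_cancel ?_
  linear_combination e * hra - d * hsb + hab'

theorem den_coprime (hx : ReducesTo m x r) : x.den.Coprime m := by
  obtain ⟨a, d, hd, hxa, -⟩ := hx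
  refine Nat.Coprime.of_dvd_left ?_ hd
  have h : x.num * d = x.den * a := by
    have : (x.num : ℚ) * d = x.den * a := by
      rw [← hxa, ← Rat.mul_den_eq_num]
      ring
    exact_mod_cast this
  have hdvd : x.den ∣ x.num.natAbs * d := by
    simpa [Int.natAbs_mul] using Int.natAbs_dvd_natAbs.mpr ⟨a, h⟩
  exact x.reduced.symm.dvd_of_dvd_mul_left hdvd

theorem exists_of_den_coprime (h : x.den.Coprime m) : ∃ r, ReducesTo m x r := by
  refine ⟨(x.num : ZMod m) * (x.den : ZMod m)⁻¹, x.num, x.den, h, Rat.mul_den_eq_num x, ?_⟩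
  linear_combination (x.num : ZMod m) * ZMod.coe_mul_inv_eq_one x.den h

theorem zero_iff : ReducesTo m x 0 ↔ x.den.Coprime m ∧ (m : ℤ) ∣ x.num := by
  rw [← ZMod.intCast_zmod_eq_zero_iff_dvd]
  constructor
  · intro h
    have hnum := (natCast m x.den).mul h
    rw [mul_comm, Rat.mul_den_eq_num, mul_zero] at hnum
    exact ⟨h.den_coprime, (intCast m x.num).unique hnum⟩
  · rintro ⟨hd, hnum⟩
    exact ⟨x.num, x.den, hd, Rat.mul_den_eq_num x, by rw [hnum, zero_mul]⟩

end ReducesTo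

theorem ratModEq_iff {m : ℕ} {x y : ℚ} :
    RatModEq m x y ↔ ∃ r, ReducesTo m x r ∧ ReducesTo m y r := by
  constructor
  · rintro ⟨hx, hy, hxy⟩
    obtain ⟨r, hr⟩ := ReducesTo.exists_of_den_coprime hx
    obtain ⟨s, hs⟩ := ReducesTo.exists_of_den_coprime hy
    have hrs := hr.sub hs
    have h0 : r - s = 0 := hrs.unique (ReducesTo.zero_iff.2 ⟨hrs.den_coprime, hxy⟩)
    exact ⟨r, hr, by rwa [sub_eq_zero.1 h0]⟩
  · rintro ⟨r, hx, hy⟩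
    have hxy := hx.sub hy
    rw [sub_self] at hxy
    exact ⟨hx.den_coprime, hy.den_coprime, (ReducesTo.zero_iff.1 hxy).2⟩

namespace RatModEq

variable {m : ℕ} {x y z : ℚ}

theorem trans (hxy : RatModEq m x y) (hyz : RatModEq m y z) : RatModEq m x z := by
  obtain ⟨r, hx, hy⟩ := ratModEq_iff.1 hxy
  obtain ⟨s, hy', hz⟩ := ratModEq_iff.1 hyz
  exact ratModEq_iff.2 ⟨r, hx, by rwa [hy.unique hy']⟩

theorem natCast_mul (k : ℕ) (h : RatModEq m x y) : RatModEq m (k * x) (k * y) := by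
  obtain ⟨r, hx, hy⟩ := ratModEq_iff.1 h
  exact ratModEq_iff.2 ⟨k * r, (ReducesTo.natCast m k).mul hx, (ReducesTo.natCast m k).mul hy⟩

theorem natCast_mul_lift {k : ℕ} (hk : k ∣ m) (h : RatModEq m x y) :
    RatModEq (k * m) (k * x) (k * y) := by
  obtain ⟨hx, hy, c, hc⟩ := h
  have hlift {d : ℕ} (hd : d.Coprime m) : d.Coprime (k * m) := (hd.of_dvd_right hk).mul_right hd
  obtain ⟨a, ha⟩ := ReducesTo.exists_of_den_coprime (hlift hx)
  obtain ⟨b, hb⟩ := ReducesTo.exists_of_den_coprime (hlift hy)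
  have hk' := ReducesTo.natCast (k * m) k
  have hkm : ((k * m : ℕ) : ℚ) * c = k * (x - y) * (x - y).den := by
    rw [mul_assoc, Rat.mul_den_eq_num, hc]
    push_cast
    ring
  have h0 : ReducesTo (k * m) (k * (x - y)) 0 :=
    ⟨(k * m : ℕ) * c, (x - y).den, (ha.sub hb).den_coprime, by exact_mod_cast hkm.symm, by
      rw [Int.cast_mul, Int.cast_natCast, ZMod.natCast_self, zero_mul, zero_mul]⟩
  rw [mul_sub] at h0
  have hab := ((hk'.mul ha).sub (hk'.mul hb)).unique h0
  exact ratModEq_iff.2 ⟨k * a, hk'.mul ha, by rw [sub_eq_zero.1 hab]; exact hk'.mul hb⟩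

end RatModEq

/-- The power series `∑ X ^ i / i` over the `i` prime to `n`. Its cube has `harmonicZ n` as its
`n`-th coefficient over `ℚ`, and the same construction over `ZMod m` computes residues. -/
def coprimeInvSeries (R : Type*) [Semiring R] [Inv R] (n : ℕ) : R⟦X⟧ :=
  mk fun i => if i.Coprime n then (i : R)⁻¹ else 0

theorem harmonicZ_eq_coeff {n : ℕ} (hn : 1 < n) :
    harmonicZ n = coeff n (coprimeInvSeries ℚ n ^ 3) := by
  rw [pow_succ', sq, coeff_mul]
  simp only [coeff_mul, mul_sum, sum_sigma']
  refine sum_of_injOn (fun t => ⟨(t.1, t.2.1 + t.2.2), (t.2.1, t.2.2)⟩) ?_ ?_ ?_ ?_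
  · rintro ⟨i, j, k⟩ - ⟨i', j', k'⟩ - h
    simp_all
  · rintro ⟨i, j, k⟩ h
    obtain ⟨-, hn, -⟩ := mem_filter.1 h
    simpa [add_assoc] using hn
  · rintro ⟨⟨i, b⟩, ⟨j, k⟩⟩ h hnot
    simp only [mem_sigma, mem_antidiagonal] at h
    obtain ⟨hn', rfl⟩ := h
    have hpos {l : ℕ} (hl : l.Coprime n) : 1 ≤ l :=
      Nat.pos_of_ne_zero fun h => by simp [h, hn.ne'] at hl
    by_contra hne
    simp only [coprimeInvSeries, coeff_mk, mul_eq_zero, ite_eq_right_iff, not_or,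
      Classical.not_imp] at hne
    obtain ⟨⟨hi, -⟩, ⟨hj, -⟩, hk, -⟩ := hne
    refine hnot ⟨(i, j, k), ?_, rfl⟩
    simp only [coe_filter, mem_product, mem_Icc, Set.mem_ofPred_eq]
    have := hpos hi
    have := hpos hj
    have := hpos hk
    refine ⟨by omega, by omega, hi, hj, hk⟩
  · rintro ⟨i, j, k⟩ h
    obtain ⟨-, -, hi, hj, hk⟩ := mem_filter.1 h
    change _ = coeff i _ * (coeff j _ * coeff k _)
    simp only [coprimeInvSeries, coeff_mk, if_pos hi, if_pos hj, if_pos hk]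
    field

theorem reducesTo_coeff_coprimeInvSeries {m n : ℕ} (k : ℕ) (hmn : m ∣ n ^ k) (hn : 1 < n) (i : ℕ) :
    ReducesTo m (coeff i (coprimeInvSeries ℚ n)) (coeff i (coprimeInvSeries (ZMod m) n)) := by
  simp only [coprimeInvSeries, coeff_mk]
  split_ifs with hi
  · have hi0 : i ≠ 0 := by
      rintro rfl
      simp [hn.ne'] at hi
    exact ReducesTo.inv_natCast ((hi.pow_right k).of_dvd_right hmn) hi0
  · exact zero_mem _

theorem reducesTo_harmonicZ {m n k : ℕ} (hmn : m ∣ n ^ k) (hn : 1 < n) :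
    ReducesTo m (harmonicZ n) (coeff n (coprimeInvSeries (ZMod m) n ^ 3)) := by
  rw [harmonicZ_eq_coeff hn]
  exact ReducesTo.coeff_pow (reducesTo_coeff_coprimeInvSeries k hmn hn) 3 n

section CoeffExpand

variable {R : Type*} [CommRing R]

theorem coeff_mul_expand {q : ℕ} (hq : q ≠ 0) (φ ψ : R⟦X⟧) (n : ℕ) :
    coeff (q * n) (φ * expand q hq ψ) =
      ∑ x ∈ antidiagonal n, coeff (q * x.1) φ * coeff x.2 ψ := by
  rw [coeff_mul]
  refine (sum_of_injOn (fun x : ℕ × ℕ => (q * x.1, q * x.2)) ?_ ?_ ?_ ?_).symm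
  · rintro ⟨s, t⟩ - ⟨s', t'⟩ - h
    simpa [hq] using h
  · rintro ⟨s, t⟩ h
    simp only [mem_coe, mem_antidiagonal] at h ⊢
    rw [← h, mul_add]
  · rintro ⟨i, j⟩ h hnot
    rw [mem_antidiagonal] at h
    rw [coeff_expand_of_not_dvd, mul_zero]
    rintro ⟨t, rfl⟩
    obtain ⟨s, rfl⟩ : q ∣ i := (Nat.dvd_add_left ⟨t, rfl⟩).1 ⟨n, h⟩
    refine hnot ⟨(s, t), ?_, rfl⟩
    rw [← mul_add] at h
    simpa using Nat.eq_of_mul_eq_mul_left (Nat.pos_of_ne_zero hq) h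
  · rintro ⟨s, t⟩ -
    rw [coeff_expand_mul]

theorem coeff_trunc_mul_expand {N : ℕ} (hN : N ≠ 0) (φ ψ : R⟦X⟧) (n : ℕ) :
    coeff n (trunc N φ * expand N hN ψ : R⟦X⟧) = coeff (n % N) φ * coeff (n / N) ψ := by
  have hmod := Nat.mod_lt n (Nat.pos_of_ne_zero hN)
  rw [coeff_mul, sum_eq_single (n % N, N * (n / N)), coeff_expand_mul, Polynomial.coeff_coe,
    coeff_trunc, if_pos hmod]
  · rintro ⟨i, j⟩ hij hne
    rw [mem_antidiagonal] at hij
    rw [Polynomial.coeff_coe, coeff_trunc]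
    split_ifs with hi
    · rw [coeff_expand_of_not_dvd, mul_zero]
      rintro ⟨t, rfl⟩
      refine hne ?_
      rw [← hij, Nat.add_mul_mod_self_left, Nat.mod_eq_of_lt hi,
        Nat.add_mul_div_left _ _ (Nat.pos_of_ne_zero hN), Nat.div_eq_of_lt hi, zero_add]
    · rw [zero_mul]
  · intro h
    exact absurd (mem_antidiagonal.2 (Nat.mod_add_div n N)) h

theorem coeff_polynomial_mul_expand {N k : ℕ} (hN : N ≠ 0) {P : Polynomial R}
    (hP : P.natDegree < N * k) (ψ : R⟦X⟧) (n : ℕ) :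
    coeff (N * n) (P * expand N hN ψ : R⟦X⟧) =
      ∑ s ∈ range k, P.coeff (N * s) * coeff n (X ^ s * ψ) := by
  rw [coeff_mul_expand, Nat.sum_antidiagonal_eq_sum_range_succ_mk]
  simp only [Polynomial.coeff_coe, coeff_X_pow_mul', mul_ite, mul_zero]
  rw [← sum_filter, ← sum_filter_of_ne (p := (· < k))]
  · refine sum_congr ?_ fun _ _ => rfl
    ext s
    simp only [mem_filter, mem_range]
    omega
  · intro s _ hs
    by_contra hk
    refine hs ?_
    rw [P.coeff_eq_zero_of_natDegree_lt, zero_mul]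
    exact hP.trans_le (Nat.mul_le_mul_left N (not_lt.1 hk))

theorem coeff_X_pow_mul_mk_one_pow (n s : ℕ) {d : ℕ} (hd : d ≠ 0) :
    coeff n (X ^ s * (mk 1 : R⟦X⟧) ^ (d + 1)) = ((n + d - s).choose d : R) := by
  rw [mk_one_pow_eq_mk_choose_add, coeff_X_pow_mul', coeff_mk]
  split_ifs with h
  · congr 2
    omega
  · rw [Nat.choose_eq_zero_of_lt (by omega), Nat.cast_zero]

end CoeffExpand

section Lift

variable {R : Type*} [CommRing R] {N : ℕ} {φ ψ : R⟦X⟧}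

theorem eq_trunc_mul_expand_sub (hN : N ≠ 0)
    (hstep : ∀ a x, coeff (a + N * x) φ = coeff a φ - N * x * coeff a ψ) :
    φ = trunc N φ * expand N hN (mk 1 : R⟦X⟧) -
      (N : R⟦X⟧) * trunc N ψ * expand N hN (X * mk 1 ^ 2 : R⟦X⟧) := by
  ext n
  have hx : coeff (n / N) (X * mk 1 ^ 2 : R⟦X⟧) = (n / N : ℕ) := by
    rw [← pow_one X, coeff_X_pow_mul_mk_one_pow _ _ one_ne_zero, Nat.add_sub_cancel,
      Nat.choose_one_right]
  rw [map_sub, mul_assoc, ← map_natCast (C (R := R)), coeff_C_mul, coeff_trunc_mul_expand,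
    coeff_trunc_mul_expand, hx, coeff_mk]
  conv_lhs => rw [← Nat.mod_add_div n N, hstep]
  simp only [Pi.one_apply]
  ring

theorem natDegree_trunc_pow_mul_trunc_lt (hN : N ≠ 0) :
    (trunc N φ ^ 2 * trunc N ψ).natDegree < N * 3 := by
  obtain ⟨M, rfl⟩ := Nat.exists_eq_succ_of_ne_zero hN
  have hφ := natDegree_trunc_lt φ M
  have hψ := natDegree_trunc_lt ψ M
  have := Polynomial.natDegree_mul_le (p := trunc (M + 1) φ ^ 2) (q := trunc (M + 1) ψ)
  have := Polynomial.natDegree_pow_le (p := trunc (M + 1) φ) (n := 2)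
  lia

theorem coeff_cube_eq (hN : N ≠ 0) (hN2 : (N : R) ^ 2 = 0) (h0 : coeff 0 φ = 0)
    (hstep : ∀ a x, coeff (a + N * x) φ = coeff a φ - N * x * coeff a ψ) (m : ℕ) :
    coeff (N * m) (φ ^ 3) =
      (m + 1).choose 2 * (trunc N φ ^ 3).coeff N + m.choose 2 * (trunc N φ ^ 3).coeff (N * 2) -
      3 * N * ((m + 1).choose 3 * (trunc N φ ^ 2 * trunc N ψ).coeff N +
        m.choose 3 * (trunc N φ ^ 2 * trunc N ψ).coeff (N * 2)) := by
  have hP0 : (trunc N φ).coeff 0 = 0 := by rw [coeff_trunc, h0, ite_self]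
  have hP3 : (trunc N φ ^ 3).coeff 0 = 0 := by simp [pow_succ, hP0]
  have hPK : (trunc N φ ^ 2 * trunc N ψ).coeff 0 = 0 := by simp [pow_succ, hP0]
  have hcube : φ ^ 3 = (trunc N φ ^ 3 : Polynomial R) * expand N hN (mk 1 ^ 3 : R⟦X⟧) -
      C (3 * N : R) * ((trunc N φ ^ 2 * trunc N ψ : Polynomial R) *
        expand N hN (X * mk 1 ^ 4 : R⟦X⟧)) := by
    have hN2' : (N : R⟦X⟧) ^ 2 = 0 := by
      rw [← map_natCast (C (R := R)), ← map_pow, hN2, map_zero]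
    conv_lhs => rw [eq_trunc_mul_expand_sub hN hstep]
    simp only [map_mul, map_pow, Polynomial.coe_pow, Polynomial.coe_mul, map_natCast, map_ofNat]
    set A : R⟦X⟧ := trunc N φ * expand N hN (mk 1 : R⟦X⟧)
    set B : R⟦X⟧ := trunc N ψ * (expand N hN (X : R⟦X⟧) * expand N hN (mk 1 : R⟦X⟧) ^ 2)
    linear_combination (3 * A * B ^ 2 - N * B ^ 3) * hN2'
  have hX (s : ℕ) : (X : R⟦X⟧) ^ s * (X * mk 1 ^ 4) = X ^ (s + 1) * mk 1 ^ (3 + 1) := by ring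
  have hdeg : (trunc N φ ^ 3).natDegree < N * 3 := by
    rw [pow_succ]
    exact natDegree_trunc_pow_mul_trunc_lt hN
  rw [hcube, map_sub, coeff_C_mul, coeff_polynomial_mul_expand hN hdeg,
    coeff_polynomial_mul_expand hN (natDegree_trunc_pow_mul_trunc_lt hN)]
  simp only [hX, coeff_X_pow_mul_mk_one_pow _ _ three_ne_zero,
    coeff_X_pow_mul_mk_one_pow _ _ two_ne_zero, sum_range_succ, range_zero, sum_empty]
  simp only [mul_zero, mul_one, hP3, hPK, zero_add, Nat.reduceAdd, Nat.reduceSubDiff,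
    Nat.add_sub_cancel]
  ring

theorem mul_coeff_trunc_cube_mul_two {c : R} (h0 : coeff 0 φ = 0)
    (hrefl : ∀ a, 0 < a → a < N → c * coeff (N - a) φ = -(c * coeff a φ)) :
    c * (trunc N φ ^ 3).coeff (N * 2) = -(c * (trunc N φ ^ 3).coeff N) := by
  set P := trunc N φ with hP
  have hPN : P.natDegree ≤ N := by
    rw [Polynomial.natDegree_le_iff_coeff_eq_zero]
    intro n hn
    rw [hP, coeff_trunc, if_neg hn.not_gt]
  have hrefl' : Polynomial.C c * P.reflect N = -(Polynomial.C c * P) := by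
    ext a
    rw [Polynomial.coeff_neg, Polynomial.coeff_C_mul, Polynomial.coeff_C_mul,
      Polynomial.coeff_reflect, hP, coeff_trunc, coeff_trunc]
    rcases lt_trichotomy a N with ha | rfl | ha
    · rw [Polynomial.revAt_le ha.le, if_pos ha]
      rcases Nat.eq_zero_or_pos a with rfl | ha0
      · simp [h0]
      · rw [if_pos (by omega), hrefl a ha0 ha]
    · simp [h0]
    · simp [Polynomial.revAt_eq_self_of_lt ha, ha.not_gt]
  have hcube : Polynomial.C c * (P ^ 3).reflect (N * 3) = -(Polynomial.C c * P ^ 3) := by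
    have hmul : (P ^ 3).reflect (N * 3) = P.reflect N ^ 3 := by
      have hPP : (P * P).natDegree ≤ N + N :=
        Polynomial.natDegree_mul_le.trans (add_le_add hPN hPN)
      rw [pow_succ, pow_two, Nat.mul_succ, mul_two, Polynomial.reflect_mul _ _ hPP hPN,
        Polynomial.reflect_mul _ _ hPN hPN, pow_succ, pow_two]
    rw [hmul]
    linear_combination (P.reflect N ^ 2 - P.reflect N * P + P ^ 2) * hrefl'
  have hN := congrArg (Polynomial.coeff · N) hcube
  simpa [Polynomial.coeff_reflect, Polynomial.revAt_le (Nat.le_mul_of_pos_right N three_pos),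
    ← Nat.mul_sub_one] using hN

theorem coeff_cube_mul (hN : N ≠ 0) (hN2 : (N : R) ^ 2 = 0) (h0 : coeff 0 φ = 0)
    (hstep : ∀ a x, coeff (a + N * x) φ = coeff a φ - N * x * coeff a ψ) {m : ℕ}
    (hm : (m.choose 2 : R) * N = 0)
    (hrefl : ∀ a, 0 < a → a < N → (m.choose 2 : R) * coeff (N - a) φ = -(m.choose 2 * coeff a φ)) :
    coeff (N * m) (φ ^ 3) = (m : R) * coeff N (φ ^ 3) := by
  have hone : coeff N (φ ^ 3) = (trunc N φ ^ 3).coeff N := by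
    simpa [Nat.choose_eq_zero_of_lt] using coeff_cube_eq hN hN2 h0 hstep 1
  have h2 : ((m + 1).choose 2 : R) = m + m.choose 2 := by
    rw [Nat.choose_succ_succ, Nat.choose_one_right, Nat.cast_add]
  have h3 : ((m + 1 : ℕ) : R) * m.choose 2 = (m + 1).choose 3 * 3 := by
    exact_mod_cast congrArg (Nat.cast : ℕ → R) (Nat.add_one_mul_choose_eq m 2)
  have h3' : (m.choose 3 : R) * 3 = m.choose 2 * (m - 2 : ℕ) := by
    exact_mod_cast congrArg (Nat.cast : ℕ → R) (Nat.choose_succ_right_eq m 2)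
  rw [coeff_cube_eq hN hN2 h0 hstep, hone, h2]
  set k₁ := (trunc N φ ^ 2 * trunc N ψ).coeff N
  set k₂ := (trunc N φ ^ 2 * trunc N ψ).coeff (N * 2)
  linear_combination mul_coeff_trunc_cube_mul_two h0 hrefl + N * k₁ * h3 - N * k₂ * h3' -
    ((m + 1 : ℕ) * k₁ + (m - 2 : ℕ) * k₂) * hm

end Lift

section CoprimeInvSeries

variable {M N a : ℕ}

theorem natCast_mul_coeff_coprimeInvSeries {k : ℕ} (hM : M ∣ N ^ k) (ha : a.Coprime N) :
    (a : ZMod M) * coeff a (coprimeInvSeries (ZMod M) N) = 1 := by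
  rw [coprimeInvSeries, coeff_mk, if_pos ha,
    ZMod.coe_mul_inv_eq_one a ((ha.pow_right k).of_dvd_right hM)]

theorem coeff_coprimeInvSeries_of_not_coprime {R : Type*} [Semiring R] [Inv R]
    (ha : ¬ a.Coprime N) : coeff a (coprimeInvSeries R N) = 0 := by
  rw [coprimeInvSeries, coeff_mk, if_neg ha]

theorem coeff_add_mul_coprimeInvSeries (hM : M ∣ N ^ 2) (a x : ℕ) :
    coeff (a + N * x) (coprimeInvSeries (ZMod M) N) =
      coeff a (coprimeInvSeries (ZMod M) N) -
        N * x * coeff a (coprimeInvSeries (ZMod M) N) ^ 2 := by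
  have hiff : (a + N * x).Coprime N ↔ a.Coprime N := by simp
  by_cases ha : a.Coprime N
  · have hN : (N : ZMod M) ^ 2 = 0 := by exact_mod_cast (ZMod.natCast_eq_zero_iff _ _).2 hM
    have hu := natCast_mul_coeff_coprimeInvSeries hM ha
    have hv := natCast_mul_coeff_coprimeInvSeries hM (hiff.2 ha)
    push_cast at hv
    set u := coeff a (coprimeInvSeries (ZMod M) N)
    set v := coeff (a + N * x) (coprimeInvSeries (ZMod M) N)
    linear_combination (-v + N * x * u * v) * hu + (u - N * x * u ^ 2) * hv + u ^ 2 * v * x ^ 2 * hN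
  · rw [coeff_coprimeInvSeries_of_not_coprime ha,
      coeff_coprimeInvSeries_of_not_coprime (mt hiff.1 ha)]
    ring

theorem mul_coeff_sub_coprimeInvSeries {k : ℕ} (hM : M ∣ N ^ k) {c : ZMod M} (hc : c * N = 0)
    (ha : a ≤ N) : c * coeff (N - a) (coprimeInvSeries (ZMod M) N) =
      -(c * coeff a (coprimeInvSeries (ZMod M) N)) := by
  have hiff : (N - a).Coprime N ↔ a.Coprime N := Nat.coprime_self_sub_left ha
  by_cases haN : a.Coprime N
  · have hu := natCast_mul_coeff_coprimeInvSeries hM haN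
    have hv := natCast_mul_coeff_coprimeInvSeries hM (hiff.2 haN)
    rw [Nat.cast_sub ha] at hv
    set u := coeff a (coprimeInvSeries (ZMod M) N)
    set v := coeff (N - a) (coprimeInvSeries (ZMod M) N)
    linear_combination (-c * v) * hu - c * u * hv + u * v * hc
  · rw [coeff_coprimeInvSeries_of_not_coprime haN,
      coeff_coprimeInvSeries_of_not_coprime (mt hiff.1 haN)]
    ring

theorem coeff_mul_coprimeInvSeries_cube (hN : 1 < N) (hM : M ∣ N ^ 2) {m : ℕ}
    (hm : M ∣ m.choose 2 * N) :
    coeff (N * m) (coprimeInvSeries (ZMod M) N ^ 3) =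
      (m : ZMod M) * coeff N (coprimeInvSeries (ZMod M) N ^ 3) := by
  have hN2 : (N : ZMod M) ^ 2 = 0 := by exact_mod_cast (ZMod.natCast_eq_zero_iff _ _).2 hM
  have hmN : (m.choose 2 : ZMod M) * N = 0 := by
    exact_mod_cast (ZMod.natCast_eq_zero_iff _ _).2 hm
  refine coeff_cube_mul (ψ := mk fun a => coeff a (coprimeInvSeries (ZMod M) N) ^ 2) (by omega) hN2
    (coeff_coprimeInvSeries_of_not_coprime (by simp [hN.ne'])) (fun a x => ?_) hmN
    fun a _ ha => mul_coeff_sub_coprimeInvSeries hM hmN ha.le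
  rw [coeff_mk, coeff_add_mul_coprimeInvSeries hM]

theorem coprimeInvSeries_mul_of_dvd_pow {R : Type*} [Semiring R] [Inv R] {m k : ℕ}
    (hm : m ∣ N ^ k) : coprimeInvSeries R (N * m) = coprimeInvSeries R N := by
  have hcop (i : ℕ) : i.Coprime (N * m) ↔ i.Coprime N :=
    ⟨fun h => h.of_dvd_right (dvd_mul_right N m),
      fun h => h.mul_right ((h.pow_right k).of_dvd_right hm)⟩
  simp only [coprimeInvSeries, hcop]

theorem ratModEq_harmonicZ_mul {m k : ℕ} (hN : 1 < N) (hM : M ∣ N ^ 2) (hm : m ∣ N ^ k)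
    (hMm : M ∣ m.choose 2 * N) : RatModEq M (harmonicZ (N * m)) (m * harmonicZ N) := by
  have hm0 : 0 < m := Nat.pos_of_dvd_of_pos hm (by positivity)
  have hred := reducesTo_harmonicZ (hM.trans (pow_dvd_pow_of_dvd (dvd_mul_right N m) 2))
    (hN.trans_le (Nat.le_mul_of_pos_right N hm0))
  rw [coprimeInvSeries_mul_of_dvd_pow hm, coeff_mul_coprimeInvSeries_cube hN hM hMm] at hred
  exact ratModEq_iff.2 ⟨_, hred, (ReducesTo.natCast M m).mul (reducesTo_harmonicZ hM hN)⟩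

end CoprimeInvSeries

theorem ratModEq_harmonicZ_prime_pow_mul {p n : ℕ} (hp : p.Prime) (hp2 : p ≠ 2) (hn : 0 < n)
    (hpn : p ∣ n) (a : ℕ) :
    RatModEq (p ^ (a + 1)) (harmonicZ (p ^ a * n)) (p ^ a * harmonicZ n) := by
  induction a with
  | zero =>
    have hn1 : 1 < n := hp.one_lt.trans_le (Nat.le_of_dvd hn hpn)
    have := ratModEq_harmonicZ_mul (m := 1) (k := 0) hn1 (dvd_pow hpn two_ne_zero) (one_dvd _)
      (hpn.mul_left _)
    simpa using this
  | succ a ih =>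
    have hpN : p ^ (a + 1) ∣ p ^ a * n := pow_succ p a ▸ mul_dvd_mul_left _ hpn
    have hN : p ∣ p ^ a * n := hpn.mul_left _
    have hchoose : p ∣ p.choose 2 := hp.dvd_choose_self two_ne_zero
      (hp.two_le.lt_of_ne' hp2)
    have hstep := ratModEq_harmonicZ_mul (M := p ^ (a + 1 + 1)) (N := p ^ a * n) (m := p) (k := 1)
      (hp.one_lt.trans_le (Nat.le_of_dvd (by have := hp.pos; positivity) hN))
      (by rw [sq, pow_succ]; exact mul_dvd_mul hpN hN) (by rwa [pow_one])
      (by rw [pow_succ']; exact mul_dvd_mul hchoose hpN)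
    have hlift := ih.natCast_mul_lift (dvd_pow_self p (Nat.succ_ne_zero a))
    rw [← pow_succ'] at hlift
    have hpow : p ^ a * n * p = p ^ (a + 1) * n := by ring
    have hZ : (p : ℚ) * (p ^ a * harmonicZ n) = p ^ (a + 1) * harmonicZ n := by ring
    rw [← hpow, ← hZ]
    exact hstep.trans hlift

section ModularSums

variable {A : Type*} [AddCommMonoid A] {n : ℕ} [NeZero n]

theorem sum_range_natCast_zmod (f : ZMod n → A) : ∑ i ∈ range n, f i = ∑ x, f x := by
  refine sum_nbij' (fun i => (i : ZMod n)) ZMod.val ?_ ?_ ?_ ?_ ?_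
  · simp
  · exact fun x _ => mem_range.2 (ZMod.val_lt x)
  · exact fun i hi => ZMod.val_cast_of_lt (mem_range.1 hi)
  · simp
  · simp

theorem sum_range_add_mul_natCast_zmod (f : ZMod n → A) (a k : ℕ) :
    ∑ i ∈ range (a + n * k), f i = ∑ i ∈ range a, f i + k • ∑ x, f x := by
  induction k generalizing a with
  | zero => simp
  | succ k ih =>
    have hperiod : ∑ i ∈ range (n + a), f i = ∑ x, f x + ∑ i ∈ range a, f i := by
      rw [sum_range_add, sum_range_natCast_zmod]
      simp only [Nat.cast_add, ZMod.natCast_self, zero_add]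
    rw [show a + n * (k + 1) = n + a + n * k by ring, ih, hperiod, succ_nsmul]
    abel

theorem sum_range_mul_mod {q : ℕ} (hq : q.Coprime n) (f : ℕ → A) :
    ∑ i ∈ range n, f (q * i % n) = ∑ i ∈ range n, f i := by
  have hval : ∑ i ∈ range n, f i = ∑ i ∈ range n, f (i : ZMod n).val :=
    sum_congr rfl fun i hi => by rw [ZMod.val_cast_of_lt (mem_range.1 hi)]
  have hmod (i : ℕ) : q * i % n = ((ZMod.unitOfCoprime q hq).mulLeft (i : ZMod n)).val := by
    simp only [Units.mulLeft_apply, ZMod.coe_unitOfCoprime, ← Nat.cast_mul, ZMod.val_natCast]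
  simp only [hval, hmod]
  rw [sum_range_natCast_zmod fun x : ZMod n => f x.val,
    sum_range_natCast_zmod fun x : ZMod n => f ((ZMod.unitOfCoprime q hq).mulLeft x).val]
  exact Equiv.sum_comp (ZMod.unitOfCoprime q hq).mulLeft fun x => f x.val

end ModularSums

theorem coeff_mul_expand_of_coeff_mul_eq {R : Type*} [CommRing R] {q : ℕ} (hq : q ≠ 0) {c : R}
    {φ : R⟦X⟧} (hφ : ∀ n, coeff (q * n) φ = c * coeff n φ) (ψ : R⟦X⟧) (n : ℕ) :
    coeff (q * n) (φ * expand q hq ψ) = c * coeff n (φ * ψ) := by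
  rw [coeff_mul_expand, coeff_mul, mul_sum]
  simp only [hφ, mul_assoc]

theorem sum_inv_eq_zero {K : Type*} [Field K] [Fintype K] (h2 : (2 : K) ≠ 0) :
    ∑ x : K, x⁻¹ = 0 := by
  have hneg := Equiv.sum_comp (Equiv.neg K) fun x => x⁻¹
  simp only [Equiv.neg_apply, inv_neg, sum_neg_distrib] at hneg
  have : 2 * ∑ x : K, x⁻¹ = 0 := by linear_combination -hneg
  exact (mul_eq_zero.1 this).resolve_left h2

theorem inv_mul_inv_eq_of_add_ne_zero {K : Type*} [Field K] [DecidableEq K] {x y : K}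
    (h : x + y ≠ 0) :
    x⁻¹ * y⁻¹ = (x + y)⁻¹ * ((x⁻¹ - if x = 0 then (x + y)⁻¹ else 0) +
      (y⁻¹ - if y = 0 then (x + y)⁻¹ else 0)) := by
  rcases eq_or_ne x 0 with rfl | hx
  · have hy : y ≠ 0 := by rwa [zero_add] at h
    simp [hy]
  rcases eq_or_ne y 0 with rfl | hy
  · simp [hx]
  rw [if_neg hx, if_neg hy]
  field

section PrimeField

variable {p : ℕ} [Fact p.Prime]

theorem two_ne_zero_zmod (hp2 : p ≠ 2) : (2 : ZMod p) ≠ 0 :=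
  Ring.two_ne_zero (by rwa [ZMod.ringChar_zmod_n])

theorem coeff_coprimeInvSeries_prime (i : ℕ) :
    coeff i (coprimeInvSeries (ZMod p) p) = (i : ZMod p)⁻¹ := by
  have hi : i.Coprime p ↔ ¬ (i : ZMod p) = 0 := by
    rw [Nat.coprime_comm, (Fact.out : p.Prime).coprime_iff_not_dvd, ZMod.natCast_eq_zero_iff]
  rw [coprimeInvSeries, coeff_mk]
  split_ifs with h
  · rfl
  · rw [not_not.1 (mt hi.2 h), inv_zero]

theorem coprimeInvSeries_prime_mul_prime {q : ℕ} (hq : q.Prime) :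
    coprimeInvSeries (ZMod p) (p * q) = coprimeInvSeries (ZMod p) p -
      C (q : ZMod p)⁻¹ * expand q hq.ne_zero (coprimeInvSeries (ZMod p) p) := by
  ext i
  have hiq : i.Coprime q ↔ ¬ q ∣ i := by rw [Nat.coprime_comm, hq.coprime_iff_not_dvd]
  rw [map_sub, coeff_C_mul]
  by_cases h : q ∣ i
  · rw [coeff_coprimeInvSeries_of_not_coprime
      (mt Nat.Coprime.coprime_mul_left_right (hiq.not.2 (not_not.2 h)))]
    obtain ⟨t, rfl⟩ := h
    simp only [coeff_expand_mul, coeff_coprimeInvSeries_prime, Nat.cast_mul, mul_inv, sub_self]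
  · have hcop : i.Coprime (p * q) ↔ i.Coprime p := by
      rw [Nat.coprime_mul_iff_right, and_iff_left (hiq.2 h)]
    rw [coeff_expand_of_not_dvd _ _ _ h, mul_zero, sub_zero]
    simp only [coprimeInvSeries, coeff_mk, hcop]

variable (p) in
/-- The harmonic sum `∑ 1 / j` over `j < n`, in `ZMod p`, where `1 / 0 = 0`. -/
def harmonicMod (n : ℕ) : ZMod p :=
  ∑ j ∈ range n, (j : ZMod p)⁻¹

variable (p) in
/-- The sum of `1 / (i * i * j)` over `j < i < p`, in `ZMod p`. -/
def doubleHarmonicMod : ZMod p :=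
  ∑ i ∈ range p, (i : ZMod p)⁻¹ ^ 2 * harmonicMod p i

variable (p) in
/-- The sum of `⌊q * i / p⌋ / (q * i) ^ 3` over `i < p`, in `ZMod p`. -/
def floorSumMod (q : ℕ) : ZMod p :=
  ∑ i ∈ range p, (q * i / p : ℕ) * (q * i : ZMod p)⁻¹ ^ 3

theorem sum_range_succ_inv_sub_ite (hp2 : p ≠ 2) (n : ℕ) :
    ∑ j ∈ range (n + 1), ((j : ZMod p)⁻¹ - if (j : ZMod p) = 0 then (n : ZMod p)⁻¹ else 0) =
      harmonicMod p (n % p) - (n / p : ℕ) * (n : ZMod p)⁻¹ := by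
  have hn : n + 1 = n % p + 1 + p * (n / p) := by
    rw [add_right_comm, Nat.mod_add_div]
  have hfull : ∑ x : ZMod p, (x⁻¹ - if x = 0 then (n : ZMod p)⁻¹ else 0) = -(n : ZMod p)⁻¹ := by
    simp [sum_sub_distrib, sum_inv_eq_zero (two_ne_zero_zmod hp2)]
  have hrest : ∑ j ∈ range (n % p + 1), (if (j : ZMod p) = 0 then (n : ZMod p)⁻¹ else 0) =
      (n : ZMod p)⁻¹ := by
    rw [sum_eq_single_of_mem 0 (by simp), Nat.cast_zero, if_pos rfl]
    intro j hj hj0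
    rw [if_neg]
    rw [ZMod.natCast_eq_zero_iff]
    refine Nat.not_dvd_of_pos_of_lt (Nat.pos_of_ne_zero hj0) ?_
    have := mem_range.1 hj
    have := Nat.mod_lt n (Fact.out : p.Prime).pos
    omega
  conv_lhs => rw [hn]
  rw [sum_range_add_mul_natCast_zmod
      (fun x => x⁻¹ - if x = 0 then (n : ZMod p)⁻¹ else 0),
    hfull, sum_sub_distrib, hrest, sum_range_succ, ZMod.natCast_mod, harmonicMod, nsmul_eq_mul]
  ring

theorem inv_mul_coeff_coprimeInvSeries_sq (hp2 : p ≠ 2) (n : ℕ) :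
    (n : ZMod p)⁻¹ * coeff n (coprimeInvSeries (ZMod p) p ^ 2) =
      2 * (n : ZMod p)⁻¹ ^ 2 * (harmonicMod p (n % p) - (n / p : ℕ) * (n : ZMod p)⁻¹) := by
  rcases eq_or_ne (n : ZMod p) 0 with hn | hn
  · simp [hn]
  set f : ℕ → ZMod p := fun j => (j : ZMod p)⁻¹ - if (j : ZMod p) = 0 then (n : ZMod p)⁻¹ else 0
  have hterm : ∀ x ∈ antidiagonal n, coeff x.1 (coprimeInvSeries (ZMod p) p) *
      coeff x.2 (coprimeInvSeries (ZMod p) p) = (n : ZMod p)⁻¹ * (f x.1 + f x.2) := by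
    intro x hx
    have hsum : (x.1 : ZMod p) + x.2 = n := by rw [← Nat.cast_add, mem_antidiagonal.1 hx]
    rw [coeff_coprimeInvSeries_prime, coeff_coprimeInvSeries_prime,
      inv_mul_inv_eq_of_add_ne_zero (hsum ▸ hn), hsum]
  have hswap : ∑ x ∈ antidiagonal n, f x.2 = ∑ x ∈ antidiagonal n, f x.1 :=
    Nat.sum_antidiagonal_swap (f := fun x : ℕ × ℕ => f x.1)
  rw [sq, coeff_mul, sum_congr rfl hterm, ← mul_sum, sum_add_distrib, hswap,
    Nat.sum_antidiagonal_eq_sum_range_succ_mk, sum_range_succ_inv_sub_ite hp2]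
  ring

theorem coeff_mul_expand_coprimeInvSeries {q : ℕ} (hq : q ≠ 0) (φ : (ZMod p)⟦X⟧) :
    coeff (q * p) (φ * expand q hq (coprimeInvSeries (ZMod p) p)) =
      -∑ i ∈ range p, coeff (q * i) φ * (i : ZMod p)⁻¹ := by
  have hterm : ∀ x ∈ antidiagonal p,
      coeff (q * x.1) φ * coeff x.2 (coprimeInvSeries (ZMod p) p) =
        -(coeff (q * x.1) φ * (x.1 : ZMod p)⁻¹) := by
    intro x hx
    have hsum : (x.1 : ZMod p) + x.2 = 0 := by
      rw [← Nat.cast_add, mem_antidiagonal.1 hx, ZMod.natCast_self]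
    rw [coeff_coprimeInvSeries_prime, eq_neg_of_add_eq_zero_right hsum, inv_neg, mul_neg]
  rw [coeff_mul_expand, sum_congr rfl hterm, Nat.sum_antidiagonal_eq_sum_range_succ_mk,
    sum_range_succ, ZMod.natCast_self, inv_zero, mul_zero, neg_zero, add_zero, sum_neg_distrib]

theorem coeff_coprimeInvSeries_sq_mul_expand (hp2 : p ≠ 2) {q : ℕ} (hq0 : q ≠ 0)
    (hq : q.Coprime p) :
    (q : ZMod p)⁻¹ * coeff (q * p) (coprimeInvSeries (ZMod p) p ^ 2 *
      expand q hq0 (coprimeInvSeries (ZMod p) p)) =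
      -2 * (doubleHarmonicMod p - floorSumMod p q) := by
  have hdouble : doubleHarmonicMod p =
      ∑ i ∈ range p, ((q * i : ℕ) : ZMod p)⁻¹ ^ 2 * harmonicMod p (q * i % p) := by
    rw [doubleHarmonicMod, ← sum_range_mul_mod hq]
    simp only [ZMod.natCast_mod]
  have hterm (i : ℕ) : (q : ZMod p)⁻¹ *
      (coeff (q * i) (coprimeInvSeries (ZMod p) p ^ 2) * (i : ZMod p)⁻¹) =
      2 * (((q * i : ℕ) : ZMod p)⁻¹ ^ 2 * harmonicMod p (q * i % p) -
        (q * i / p : ℕ) * (q * i : ZMod p)⁻¹ ^ 3) := by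
    have hsq := inv_mul_coeff_coprimeInvSeries_sq hp2 (q * i)
    rw [Nat.cast_mul, mul_inv] at hsq ⊢
    linear_combination hsq
  rw [coeff_mul_expand_coprimeInvSeries, hdouble, floorSumMod, ← sum_sub_distrib, mul_neg, mul_sum,
    neg_mul, mul_sum]
  simp only [hterm]

theorem coeff_coprimeInvSeries_cube_prime (hp2 : p ≠ 2) :
    coeff p (coprimeInvSeries (ZMod p) p ^ 3) = -2 * doubleHarmonicMod p := by
  have hfloor : floorSumMod p 1 = 0 := by
    refine sum_eq_zero fun i hi => ?_
    rw [one_mul, Nat.div_eq_of_lt (mem_range.1 hi), Nat.cast_zero, zero_mul]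
  simpa [expand_one, hfloor, ← pow_succ] using
    coeff_coprimeInvSeries_sq_mul_expand hp2 one_ne_zero (Nat.coprime_one_left p)

theorem coeff_coprimeInvSeries_cube_prime_mul_prime (hp2 : p ≠ 2) {q : ℕ} (hq : q.Prime)
    (hqp : q.Coprime p) :
    coeff (p * q) (coprimeInvSeries (ZMod p) (p * q) ^ 3) =
      (6 - 2 * q - 4 * (q : ZMod p)⁻¹ ^ 3) * doubleHarmonicMod p - 6 * floorSumMod p q := by
  set S := coprimeInvSeries (ZMod p) p
  set E := expand q hq.ne_zero S
  have hS : coeff (p * q) (S ^ 3) = (q : ZMod p) * coeff p (S ^ 3) :=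
    coeff_mul_coprimeInvSeries_cube (Fact.out : p.Prime).one_lt (dvd_pow_self p two_ne_zero)
      (dvd_mul_left p _)
  have hSE : coeff (p * q) (S * E ^ 2) = (q : ZMod p)⁻¹ * coeff p (S ^ 3) := by
    have hcoeff (n : ℕ) : coeff (q * n) S = (q : ZMod p)⁻¹ * coeff n S := by
      simp only [S, coeff_coprimeInvSeries_prime, Nat.cast_mul, mul_inv]
    rw [mul_comm p, ← map_pow, coeff_mul_expand_of_coeff_mul_eq _ hcoeff, ← pow_succ']
  have hE : coeff (p * q) (E ^ 3) = coeff p (S ^ 3) := by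
    rw [mul_comm p, ← map_pow, coeff_expand_mul]
  have hcube : (S - C (q : ZMod p)⁻¹ * E) ^ 3 = S ^ 3 - C (3 * (q : ZMod p)⁻¹) * (S ^ 2 * E) +
      C (3 * (q : ZMod p)⁻¹ ^ 2) * (S * E ^ 2) - C ((q : ZMod p)⁻¹ ^ 3) * E ^ 3 := by
    simp only [map_mul, map_pow, map_ofNat]
    ring
  rw [coprimeInvSeries_prime_mul_prime hq, hcube]
  simp only [map_sub, map_add, coeff_C_mul]
  rw [hS, hSE, hE, coeff_coprimeInvSeries_cube_prime hp2]
  have := coeff_coprimeInvSeries_sq_mul_expand hp2 hq.ne_zero hqp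
  rw [mul_comm q] at this
  linear_combination -3 * this

end PrimeField

section Bernoulli

variable {p : ℕ} [Fact p.Prime]

theorem ReducesTo.ratCast {x : ℚ} (h : x.den.Coprime p) : ReducesTo p x (x : ZMod p) := by
  have hd : (x.den : ZMod p) ≠ 0 := (ZMod.unitOfCoprime x.den h).isUnit.ne_zero
  refine ⟨x.num, x.den, h, Rat.mul_den_eq_num x, ?_⟩
  rw [Rat.cast_def, div_mul_cancel₀ _ hd]

theorem coprime_prime_of_pos_of_lt {d : ℕ} (h0 : 0 < d) (hd : d < p) : d.Coprime p :=
  (Nat.coprime_of_lt_prime h0.ne' hd Fact.out).symm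

theorem reducesTo_bernoulli {n : ℕ} (hn : n < p - 1) :
    ReducesTo p (bernoulli n) (bernoulli n : ZMod p) := by
  refine ReducesTo.ratCast ?_
  induction n using Nat.strong_induction_on with
  | _ n ih =>
    have hrec := sum_bernoulli (n + 1)
    rw [sum_range_succ, Nat.choose_succ_self_right] at hrec
    have hB : bernoulli n = ((n + 1 : ℕ) : ℚ)⁻¹ * (((if n + 1 = 1 then 1 else 0 : ℕ) : ℚ) -
        ∑ k ∈ range n, ((n + 1).choose k : ℚ) * bernoulli k) := by
      rw [eq_inv_mul_iff_mul_eq₀ (by positivity)]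
      push_cast at hrec ⊢
      linear_combination hrec
    have hinv := ReducesTo.inv_natCast (m := p)
      (coprime_prime_of_pos_of_lt (Nat.succ_pos n) (by omega)) (Nat.succ_ne_zero n)
    have hsum := ReducesTo.sum (t := range n) fun k hk =>
      (ReducesTo.natCast p ((n + 1).choose k)).mul (ReducesTo.ratCast
        (ih k (mem_range.1 hk) ((mem_range.1 hk).trans hn)))
    rw [hB]
    exact (hinv.mul ((ReducesTo.natCast p _).sub hsum)).den_coprime

theorem inv_pow_eq_pow_sub {x : ZMod p} (hx : x ≠ 0) {a : ℕ} (ha : a ≤ p - 1) :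
    x⁻¹ ^ a = x ^ (p - 1 - a) := by
  rw [inv_pow]
  refine inv_eq_of_mul_eq_one_right ?_
  rw [← pow_add, Nat.add_sub_cancel' ha, ZMod.pow_card_sub_one_eq_one hx]

theorem inv_eq_pow_sub_two (hp2 : p ≠ 2) (x : ZMod p) : x⁻¹ = x ^ (p - 2) := by
  have hp := (Fact.out : p.Prime).two_le
  rcases eq_or_ne x 0 with rfl | hx
  · rw [inv_zero, zero_pow (by omega)]
  · rw [← pow_one x⁻¹, inv_pow_eq_pow_sub hx (by omega), Nat.sub_sub]

theorem sum_pow_eq_ite {e : ℕ} (he : e ≠ 0) :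
    ∑ x : ZMod p, x ^ e = if p - 1 ∣ e then -1 else 0 := by
  have hunits := FiniteField.sum_pow_units (ZMod p) e
  rw [ZMod.card] at hunits
  rw [← hunits, ← sum_sdiff ({0} : Finset (ZMod p)).subset_univ, sum_singleton, zero_pow he,
    add_zero]
  refine (sum_nbij (fun x : (ZMod p)ˣ => (x : ZMod p)) ?_ ?_ ?_ ?_).symm
  · simp
  · exact fun x _ y _ hxy => Units.ext hxy
  · intro x hx
    exact ⟨Units.mk0 x (by simpa using hx), by simp, rfl⟩
  · simp

theorem sum_inv_sq_mul_pow (hp2 : p ≠ 2) {e : ℕ} (he0 : e ≠ 0) (he : e < p) :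
    ∑ x : ZMod p, x⁻¹ ^ 2 * x ^ e = if e = 2 then -1 else 0 := by
  have hp := (Fact.out : p.Prime).two_le
  have hdvd : p - 1 ∣ (p - 2) * 2 + e ↔ e = 2 := by
    constructor
    · intro h
      rw [show (p - 2) * 2 + e = p - 1 + (p - 3 + e) by omega, Nat.dvd_add_right dvd_rfl] at h
      have := Nat.eq_of_dvd_of_lt_two_mul (by omega) h (by omega)
      omega
    · rintro rfl
      exact ⟨2, by omega⟩
  simp only [inv_eq_pow_sub_two hp2, ← pow_mul, ← pow_add]
  rw [sum_pow_eq_ite (by omega)]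
  simp only [hdvd]

theorem harmonicMod_eq (hp2 : p ≠ 2) (n : ℕ) :
    harmonicMod p n = -∑ i ∈ range (p - 1),
      (bernoulli i : ZMod p) * (p - 1).choose i * (n : ZMod p) ^ (p - 1 - i) := by
  have hp := (Fact.out : p.Prime).two_le
  have hinv : ((p - 1 : ℕ) : ZMod p)⁻¹ = -1 := by
    rw [Nat.cast_sub (by omega), ZMod.natCast_self, Nat.cast_one, zero_sub, inv_neg, inv_one]
  have hpow : ReducesTo p (∑ k ∈ range n, (k : ℚ) ^ (p - 2)) (harmonicMod p n) :=
    ReducesTo.sum fun k _ => by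
      rw [inv_eq_pow_sub_two hp2]
      exact (ReducesTo.natCast p k).pow _
  have hfaulhaber : ReducesTo p (∑ k ∈ range n, (k : ℚ) ^ (p - 2)) (∑ i ∈ range (p - 1),
      (bernoulli i : ZMod p) * (p - 1).choose i * (n : ZMod p) ^ (p - 1 - i) *
        ((p - 1 : ℕ) : ZMod p)⁻¹) := by
    rw [sum_range_pow, show p - 2 + 1 = p - 1 by omega, ← Nat.cast_add_one,
      show p - 2 + 1 = p - 1 by omega]
    refine ReducesTo.sum fun i hi => ?_
    rw [div_eq_mul_inv]
    exact (((reducesTo_bernoulli (mem_range.1 hi)).mul (ReducesTo.natCast p _)).mul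
      ((ReducesTo.natCast p n).pow _)).mul
      (ReducesTo.inv_natCast (coprime_prime_of_pos_of_lt (by omega) (by omega)) (by omega))
  rw [hpow.unique hfaulhaber, hinv, ← sum_mul, mul_neg_one]

theorem choose_prime_sub_one_sub_three (hp : 3 ≤ p) : ((p - 1).choose (p - 3) : ZMod p) = 1 := by
  have hsymm : (p - 1).choose (p - 3) = (p - 1).choose 2 := by
    rw [← Nat.choose_symm (by omega), show p - 1 - (p - 3) = 2 by omega]
  have h2 : ((p - 1).choose 2 : ZMod p) * 2 = 2 := by
    have h := congrArg (Nat.cast : ℕ → ZMod p) (Nat.choose_succ_right_eq (p - 1) 1)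
    rw [Nat.choose_one_right, Nat.sub_sub] at h
    push_cast [Nat.cast_sub (show 1 ≤ p by omega), Nat.cast_sub (show 2 ≤ p by omega)] at h
    simp only [CharP.cast_eq_zero] at h
    linear_combination h
  rw [hsymm]
  exact mul_right_cancel₀ (two_ne_zero_zmod (by omega)) (h2.trans (one_mul 2).symm)

theorem doubleHarmonicMod_eq_bernoulli (hp : 3 ≤ p) :
    doubleHarmonicMod p = (bernoulli (p - 3) : ZMod p) := by
  have hp2 : p ≠ 2 := by omega
  have hsum : doubleHarmonicMod p = -∑ i ∈ range (p - 1), (bernoulli i : ZMod p) *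
      (p - 1).choose i * ∑ x : ZMod p, x⁻¹ ^ 2 * x ^ (p - 1 - i) := by
    simp only [doubleHarmonicMod, harmonicMod_eq hp2, mul_neg, sum_neg_distrib, mul_sum,
      ← sum_range_natCast_zmod]
    rw [sum_comm]
    refine congrArg _ (sum_congr rfl fun i _ => sum_congr rfl fun n _ => ?_)
    ring
  rw [hsum, sum_eq_single_of_mem (p - 3) (mem_range.2 (by omega)),
    choose_prime_sub_one_sub_three hp, sum_inv_sq_mul_pow hp2 (by omega) (by omega),
    if_pos (by omega)]
  · ring
  · intro i hi hne
    have := mem_range.1 hi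
    rw [sum_inv_sq_mul_pow hp2 (by omega) (by omega), if_neg (by omega), mul_zero]

theorem exists_sum_range_pow_eq {k : ℕ} (hk : 0 < k) (hkp : k < p - 1) :
    ∃ (z : ℚ) (r : ZMod p), ReducesTo p z r ∧
      ∑ i ∈ range p, (i : ℚ) ^ k = p * bernoulli k + p ^ 2 * z := by
  refine ⟨∑ i ∈ range k, bernoulli i * ((k + 1).choose i) * (p : ℚ) ^ (k - 1 - i) *
    ((k + 1 : ℕ) : ℚ)⁻¹, _, ReducesTo.sum fun i hi =>
      (((reducesTo_bernoulli ((mem_range.1 hi).trans hkp)).mul (ReducesTo.natCast p _)).mul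
        ((ReducesTo.natCast p p).pow _)).mul
        (ReducesTo.inv_natCast (coprime_prime_of_pos_of_lt (by omega) (by omega)) (by omega)), ?_⟩
  rw [sum_range_pow, sum_range_succ, add_comm, mul_sum]
  congr 1
  · rw [Nat.choose_succ_self_right, Nat.add_sub_cancel_left]
    push_cast
    field
  · refine sum_congr rfl fun i hi => ?_
    have := mem_range.1 hi
    rw [show k + 1 - i = (k - 1 - i) + 2 by omega]
    push_cast
    field

end Bernoulli

theorem sq_dvd_sum_range_pow {p q : ℕ} [NeZero p] (hq : q.Coprime p) (k : ℕ) :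
    (p : ℤ) ^ 2 ∣ (q ^ k - 1) * ∑ i ∈ range p, (i : ℤ) ^ k -
      k * p * ∑ i ∈ range p, (q * i / p : ℕ) * (q * i : ℤ) ^ (k - 1) := by
  have hterm (i : ℕ) : (p : ℤ) ^ 2 ∣ (q * i : ℤ) ^ k -
      k * p * ((q * i / p : ℕ) * (q * i : ℤ) ^ (k - 1)) - (q * i % p : ℕ) ^ k := by
    obtain ⟨w, hw⟩ := Polynomial.powAddExpansion (q * i : ℤ) (-(p * (q * i / p : ℕ))) k
    have hmod : ((q * i % p : ℕ) : ℤ) = q * i + -(p * (q * i / p : ℕ)) := by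
      have : ((q * i % p : ℕ) : ℤ) + p * (q * i / p : ℕ) = q * i := by
        exact_mod_cast Nat.mod_add_div (q * i) p
      linear_combination this
    refine ⟨-(w * (q * i / p : ℕ) ^ 2), ?_⟩
    rw [hmod, hw]
    ring
  have hsum := dvd_sum fun i (_ : i ∈ range p) => hterm i
  have hpow : ∑ i ∈ range p, (q * i : ℤ) ^ k = q ^ k * ∑ i ∈ range p, (i : ℤ) ^ k := by
    simp only [mul_pow, mul_sum]
  rw [sum_sub_distrib, sum_sub_distrib, sum_range_mul_mod hq fun i => (i : ℤ) ^ k, ← mul_sum,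
    hpow] at hsum
  rwa [sub_one_mul, sub_right_comm]

section Voronoi

variable {p : ℕ} [Fact p.Prime]

theorem voronoi_congruence {q k : ℕ} (hq : q.Coprime p) (hk : 0 < k) (hkp : k < p - 1) :
    ((q : ZMod p) ^ k - 1) * (bernoulli k : ZMod p) =
      k * ∑ i ∈ range p, (q * i / p : ℕ) * (q * i : ZMod p) ^ (k - 1) := by
  obtain ⟨z, r, hz, hsum⟩ := exists_sum_range_pow_eq hk hkp
  obtain ⟨w, hw⟩ := sq_dvd_sum_range_pow hq k
  set Q : ℤ := ∑ i ∈ range p, (q * i / p : ℕ) * (q * i : ℤ) ^ (k - 1) with hQ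
  have hrat : ((q : ℚ) ^ k - 1) * bernoulli k - k * Q = p * (w - ((q : ℚ) ^ k - 1) * z) := by
    have hw' := congrArg (Int.cast : ℤ → ℚ) hw
    push_cast at hw'
    rw [hsum] at hw'
    refine mul_left_cancel₀ (Nat.cast_ne_zero.2 (Fact.out : p.Prime).ne_zero : (p : ℚ) ≠ 0) ?_
    linear_combination hw'
  have hq1 := ((ReducesTo.natCast p q).pow k).sub (ReducesTo.natCast p 1)
  have hleft := (hq1.mul (reducesTo_bernoulli hkp)).sub
    ((ReducesTo.natCast p k).mul (ReducesTo.intCast p Q))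
  have hright := (ReducesTo.natCast p p).mul ((ReducesTo.intCast p w).sub (hq1.mul hz))
  rw [Nat.cast_one, hrat] at hleft
  rw [Nat.cast_one] at hright
  have h0 := hleft.unique hright
  rw [ZMod.natCast_self, zero_mul, sub_eq_zero, Nat.cast_one] at h0
  rw [h0, hQ]
  simp only [Int.cast_sum, Int.cast_mul, Int.cast_pow, Int.cast_natCast]

theorem three_mul_floorSumMod (hp : 3 ≤ p) {q : ℕ} (hq : q.Coprime p) :
    3 * floorSumMod p q = (1 - (q : ZMod p)⁻¹ ^ 2) * bernoulli (p - 3) := by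
  have hq0 : (q : ZMod p) ≠ 0 := (ZMod.unitOfCoprime q hq).isUnit.ne_zero
  have hqpow : (q : ZMod p)⁻¹ ^ 2 = q ^ (p - 3) := by
    rw [inv_pow_eq_pow_sub hq0 (by omega), Nat.sub_sub]
  rcases hp.eq_or_lt with rfl | hp3
  · rw [hqpow, Nat.sub_self, pow_zero, show (3 : ZMod 3) = 0 from rfl]
    ring
  have hfloor : floorSumMod p q =
      ∑ i ∈ range p, (q * i / p : ℕ) * (q * i : ZMod p) ^ (p - 3 - 1) := by
    refine sum_congr rfl fun i hi => ?_
    rcases eq_or_ne i 0 with rfl | hi0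
    · simp
    · have hqi : ((q * i : ℕ) : ZMod p) ≠ 0 := (ZMod.unitOfCoprime _ (hq.mul_left
        (coprime_prime_of_pos_of_lt (Nat.pos_of_ne_zero hi0) (mem_range.1 hi)))).isUnit.ne_zero
      rw [← Nat.cast_mul, inv_pow_eq_pow_sub hqi (by omega), Nat.sub_right_comm]
  have hV := voronoi_congruence hq (show 0 < p - 3 by omega) (by omega)
  rw [← hfloor, Nat.cast_sub hp, ZMod.natCast_self] at hV
  push_cast at hV
  rw [hqpow]
  linear_combination hV

end Voronoi

theorem coeff_coprimeInvSeries_cube_eq_bernoulli {p : ℕ} [Fact p.Prime] (hp : 3 ≤ p) {q : ℕ}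
    (hq : q.Prime) (hqp : q.Coprime p) :
    coeff (p * q) (coprimeInvSeries (ZMod p) (p * q) ^ 3) =
      2 * (2 - q) * (1 - (q : ZMod p)⁻¹ ^ 3) * bernoulli (p - 3) := by
  have hinv : (q : ZMod p) * (q : ZMod p)⁻¹ = 1 := ZMod.coe_mul_inv_eq_one q hqp
  rw [coeff_coprimeInvSeries_cube_prime_mul_prime (by omega) hq hqp,
    doubleHarmonicMod_eq_bernoulli hp]
  linear_combination -2 * three_mul_floorSumMod hp hqp -
    2 * (q : ZMod p)⁻¹ ^ 2 * bernoulli (p - 3) * hinv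

theorem ratModEq_harmonicZ_prime_mul_prime {p q : ℕ} (hp : p.Prime) (hp2 : p ≠ 2) (hq : q.Prime)
    (hpq : p ≠ q) :
    RatModEq p (harmonicZ (p * q))
      (2 * (2 - q) * (1 - 1 / (q : ℚ) ^ 3) * bernoulli (p - 3)) := by
  have : Fact p.Prime := ⟨hp⟩
  have hp3 : 3 ≤ p := hp.two_le.lt_of_ne' hp2
  have hqp : q.Coprime p := (Nat.coprime_primes hq hp).2 hpq.symm
  have hZ := reducesTo_harmonicZ (k := 1) (dvd_pow (dvd_mul_right p q) one_ne_zero)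
    (Nat.one_lt_mul_iff.2 ⟨hp.pos, hq.pos, .inl hp.one_lt⟩)
  rw [coeff_coprimeInvSeries_cube_eq_bernoulli hp3 hq hqp] at hZ
  have hinv := (ReducesTo.inv_natCast hqp hq.ne_zero).pow 3
  have hB := (((ReducesTo.natCast p 2).mul ((ReducesTo.natCast p 2).sub
    (ReducesTo.natCast p q))).mul ((ReducesTo.natCast p 1).sub hinv)).mul
    (reducesTo_bernoulli (show p - 3 < p - 1 by omega))
  refine ratModEq_iff.2 ⟨_, hZ, ?_⟩
  rw [one_div, ← inv_pow]
  exact_mod_cast hB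

theorem ratModEq_harmonicZ_mul_pow_succ {m q : ℕ} (h : 1 < m * q) (b : ℕ) :
    RatModEq m (harmonicZ (m * q ^ (b + 1))) (q ^ b * harmonicZ (m * q)) := by
  have hmul := ratModEq_harmonicZ_mul h (dvd_pow (dvd_mul_right m q) two_ne_zero)
    (pow_dvd_pow_of_dvd (dvd_mul_left q m) b) ((dvd_mul_right m q).mul_left _)
  rwa [mul_assoc, ← pow_succ', Nat.cast_pow] at hmul

theorem RatModEq.pow_mul_lift {m : ℕ} {x y : ℚ} (h : RatModEq m x y) (a : ℕ) :
    RatModEq (m ^ (a + 1)) (m ^ a * x) (m ^ a * y) := by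
  induction a with
  | zero => simpa using h
  | succ a ih =>
    have := ih.natCast_mul_lift (dvd_pow_self m (Nat.succ_ne_zero a))
    rwa [← pow_succ', ← mul_assoc, ← mul_assoc, ← pow_succ'] at this

theorem theorem2 (p q α β : ℕ) (hp : p.Prime) (hq : q.Prime) (hp2 : Odd p) (hq2 : Odd q)
    (hpq : p ≠ q) (hα : 0 < α) (hβ : 0 < β) :
    RatModEq (p ^ α) (harmonicZ (p ^ α * q ^ β))
      (2 * (2 - (q : ℚ)) * (1 - 1 / (q : ℚ) ^ 3) * (p : ℚ) ^ (α - 1) * (q : ℚ) ^ (β - 1) *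
        bernoulli (p - 3)) := by
  obtain ⟨a, rfl⟩ := Nat.exists_eq_add_of_le' hα
  obtain ⟨b, rfl⟩ := Nat.exists_eq_add_of_le' hβ
  have hp_ne_two : p ≠ 2 := hp2.ne_two_of_dvd_nat dvd_rfl
  have hbase := (ratModEq_harmonicZ_prime_mul_prime hp hp_ne_two hq hpq).natCast_mul (q ^ b)
  rw [Nat.cast_pow] at hbase
  have hmodp := (ratModEq_harmonicZ_mul_pow_succ
    (Nat.one_lt_mul_iff.2 ⟨hp.pos, hq.pos, .inl hp.one_lt⟩) b).trans hbase
  have hlift := ratModEq_harmonicZ_prime_pow_mul hp hp_ne_two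
    (Nat.mul_pos hp.pos (pow_pos hq.pos (b + 1))) (dvd_mul_right p _) a
  have hmain := hlift.trans (hmodp.pow_mul_lift a)
  rw [← mul_assoc, ← pow_succ] at hmain
  rw [Nat.add_sub_cancel, Nat.add_sub_cancel]
  convert hmain using 1
  ring
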